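/- **Setting (bandits with concave rewards and convex knapsacks, BwCR).** There are $m\ge 1$ arms, a dimension $d\ge 1$ and a horizon $T\ge 1$. Each arm $i$ has an unknown distribution on $[0,1]^d$ with mean $V_i$; let $V\in[0,1]^{d\times m}$ be the matrix with columns $V_i$. When arm $i_t$ is played at time $t$, a vector $v_t\in[0,1]^d$ is drawn from the distribution of arm $i_t$, independently of the past, and observed. Given are a convex set $S\subseteq\mathbb R^d$ and a concave $f:[0,1]^d\to[0,1]$ with $f(x)-f(y)\le L\|x-y\|$, where $\|\cdot\|$ is an $L_q$ norm ($1\le q\le\infty$); $d(x,S)$ denotes the distance to $S$ in an $L_{q'}$ norm $\|\cdot\|'$ (possibly the same). Let $\Delta_m$ be the simplex of distributions over arms, and assume that some $p\in\Delta_m$ has $Vp\in S$. Let $\mathrm{OPT}_f$ be the supremum of $\mathbb E\, f(\frac1T\sum_{t=1}^T v_t)$ over all dynamic (non-anticipating, possibly randomized) policies with $\frac1T\sum_{t=1}^T v_t\in S$ almost surely ($0$ if there is no such policy). The average regrets of an algorithm are $$\mathrm{areg}_1(T)=\mathrm{OPT}_f-f\Big(\frac1T\sum_{t=1}^T v_t\Big),\qquad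 \mathrm{areg}_2(T)=d\Big(\frac1T\sum_{t=1}^T v_t,\;S\Big).$$ **UCB algorithm with parameter $\gamma$.** Let $\mathrm{rad}(\nu,N)=\sqrt{\gamma\nu/N}+\gamma/N$, let $k_{t,i}$ be the number of plays of arm $i$ before time $t$, and let $\hat V_{t,ji}=\frac{1}{k_{t,i}+1}\sum_{s<t:\,i_s=i}v_{s,j}$. Put $$\mathrm{UCB}_{t,ji}=\min\{1,\hat V_{t,ji}+2\,\mathrm{rad}(\hat V_{t,ji},k_{t,i}+1)\},\qquad \mathrm{LCB}_{t,ji}=\max\{0,\hat V_{t,ji}-2\,\mathrm{rad}(\hat V_{t,ji},k_{t,i}+1)\},$$ and $H_t=\{\tilde V\in\mathbb R^{d\times m}:\tilde V_{ji}\in[\mathrm{LCB}_{t,ji},\mathrm{UCB}_{t,ji}]\ \text{for all } i,j\}$. At each time $t=1,\dots,T$ the algorithm takes $$p_t\in\arg\max_{p\in\Delta_m}\ \max_{\tilde U\in H_t}f(\tilde Up)\quad\text{subject to}\quad \min_{\tilde V\in H_t}d(\tilde Vp,S)\le 0$$ ($p_t\in\Delta_m$ is arbitrary if this problem is infeasible)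 and plays arm $i$ with probability $p_{t,i}$. **Theorem.** There are absolute constants $c,C>0$ such that, for all such problems and all $\delta\in(0,1)$ with $2\delta\le mTd$ (a condition only if $m=T=d=1$), every execution of the UCB algorithm with $\gamma=c\log(mTd/\delta)$ satisfies, with probability at least $1-\delta$, simultaneously $$\mathrm{areg}_1(T)\le C\,L\,\|\mathbf 1_d\|\sqrt{\frac{\gamma m}{T}},\qquad \mathrm{areg}_2(T)\le C\,\|\mathbf 1_d\|'\sqrt{\frac{\gamma m}{T}},$$ where $\mathbf 1_d\in\mathbb R^d$ is the all-ones vector. On the same event the first bound also holds with $\mathrm{OPT}_f$ replaced by $f(Vp)$, for every $p\in\Delta_m$ with $Vp\in S$. -/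

import Mathlib

open MeasureTheory
open scoped ENNReal

noncomputable section

namespace BwCR

/-- An observation: a vector in `[0,1]^d`. -/
abbrev Obs (d : ℕ) : Type := Fin d → unitInterval

/-- A history of `t` rounds: the arm played and the vector observed in each round. -/
abbrev History (m d t : ℕ) : Type := Fin t → Fin m × Obs d

/-- The cube `[0,1]^d` inside `ℝ^d`, the domain of the objective. -/
def cube (d : ℕ) : Set (Fin d → ℝ) := Set.Icc 0 1

/-- The `L_q` norm on `ℝ^d`, for `1 ≤ q ≤ ∞`. -/
def lqNorm (q : ℝ≥0∞) {d : ℕ} (x : Fin d → ℝ) : ℝ := ‖WithLp.toLp q x‖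

/-- The `L_q` distance from the point `x` to the set `S`. -/
def lqDist (q : ℝ≥0∞) [Fact (1 ≤ q)] {d : ℕ} (x : Fin d → ℝ) (S : Set (Fin d → ℝ)) : ℝ :=
  Metric.infDist (WithLp.toLp q x) (WithLp.toLp q '' S)

/-- A dynamic (adaptive, possibly randomized) policy: from the history of the first `t` rounds it
computes the distribution over the `m` arms from which the next arm is drawn. -/
structure Policy (m d : ℕ) where
  /-- The distribution over arms used after a given history. -/
  dist : (t : ℕ) → History m d t → (Fin m → ℝ)
  mem_simplex : ∀ t h, dist t h ∈ stdSimplex ℝ (Fin m)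
  measurable_dist : ∀ t, Measurable (dist t)

variable {m d : ℕ}

/-- The law of the history of the first `t` rounds when policy `π` is run and the observations of
arm `i` are drawn from `D i`. In each round, given the history `h`, arm `i` is played with
probability `π.dist t h i`, and then the observation `x` is drawn from `D i`, independently of
the past; the history `h` is extended by `(i, x)`. -/
def histLaw (D : Fin m → Measure (Obs d)) (π : Policy m d) : (t : ℕ) → Measure (History m d t)
  | 0 => Measure.dirac (fun s => Fin.elim0 s)
  | t + 1 => ∑ i : Fin m,
      (((histLaw D π t).withDensity (fun h => ENNReal.ofReal (π.dist t h i))).prod (D i)).map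
        (fun z => (Fin.snoc z.1 (i, z.2) : History m d (t + 1)))

/-- The average observed vector `(1/T) ∑ₜ vₜ` of a history of `T` rounds. -/
def avgObs {T : ℕ} (h : History m d T) : Fin d → ℝ :=
  fun j => (∑ s, ((h s).2 j : ℝ)) / T

/-- The `d × m` matrix `V` of the means: `V j i` is the mean of component `j` of arm `i`. -/
def meanMatrix (D : Fin m → Measure (Obs d)) : Matrix (Fin d) (Fin m) ℝ :=
  fun j i => ∫ x, (x j : ℝ) ∂(D i)

/-- `OPT_f`: the optimal expected objective value `𝔼 f((1/T) ∑ₜ vₜ)` over all dynamic policies whose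
average observed vector lies in `S` almost surely. The values of `f` are in `[0,1]`, so the set is
bounded; if there is no such policy then the value is `0`, the least possible one. -/
def optValue (D : Fin m → Measure (Obs d)) (f : (Fin d → ℝ) → ℝ) (S : Set (Fin d → ℝ)) (T : ℕ) :
    ℝ :=
  sSup {r | ∃ π : Policy m d, (∀ᵐ h ∂(histLaw D π T), avgObs h ∈ S) ∧
    r = ∫ h, f (avgObs h) ∂(histLaw D π T)}

/-- The average regret in the objective, on the realized history `h`. -/
def regretObj (D : Fin m → Measure (Obs d)) (f : (Fin d → ℝ) → ℝ) (S : Set (Fin d → ℝ)) {T : ℕ}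
    (h : History m d T) : ℝ :=
  optValue D f S T - f (avgObs h)

/-- The average regret in the constraints, on the realized history `h`. -/
def regretCon (q : ℝ≥0∞) [Fact (1 ≤ q)] (S : Set (Fin d → ℝ)) {T : ℕ} (h : History m d T) : ℝ :=
  lqDist q (avgObs h) S

/-- The number of plays of arm `i` in the history `h`. -/
def plays {t : ℕ} (h : History m d t) (i : Fin m) : ℕ :=
  (Finset.univ.filter (fun s => (h s).1 = i)).card

/-- The empirical average of component `j` of arm `i`, with denominator `plays + 1`. -/
def empMean {t : ℕ} (h : History m d t) (j : Fin d) (i : Fin m) : ℝ :=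
  (∑ s ∈ Finset.univ.filter (fun s => (h s).1 = i), ((h s).2 j : ℝ)) / (plays h i + 1)

/-- The confidence radius. -/
def rad (γ ν N : ℝ) : ℝ := Real.sqrt (γ * ν / N) + γ / N

/-- The upper confidence bounds. -/
def ucb (γ : ℝ) {t : ℕ} (h : History m d t) (j : Fin d) (i : Fin m) : ℝ :=
  min 1 (empMean h j i + 2 * rad γ (empMean h j i) (plays h i + 1))

/-- The lower confidence bounds. -/
def lcb (γ : ℝ) {t : ℕ} (h : History m d t) (j : Fin d) (i : Fin m) : ℝ :=
  max 0 (empMean h j i - 2 * rad γ (empMean h j i) (plays h i + 1))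

/-- The confidence hypercube `H_t` computed from the history `h`. -/
def confCube (γ : ℝ) {t : ℕ} (h : History m d t) : Set (Matrix (Fin d) (Fin m) ℝ) :=
  {V | ∀ j i, V j i ∈ Set.Icc (lcb γ h j i) (ucb γ h j i)}

/-- The distributions `p` over arms with `min_{V ∈ H_t} d(V p, S) ≤ 0`. The hypercube is compact and
the distance is continuous, so the minimum is attained and the constraint says that some
`V ∈ H_t` has `d(V p, S) ≤ 0`. -/
def feasible (q : ℝ≥0∞) [Fact (1 ≤ q)] (γ : ℝ) (S : Set (Fin d → ℝ)) {t : ℕ} (h : History m d t) :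
    Set (Fin m → ℝ) :=
  {p | p ∈ stdSimplex ℝ (Fin m) ∧ ∃ V ∈ confCube γ h, lqDist q (V.mulVec p) S ≤ 0}

/-- `p` maximizes `max_{U ∈ H_t} f(U p)` over the feasible distributions: `p` is feasible, and some
`U ∈ H_t` gives `p` a value that no feasible `p'` exceeds with any `U' ∈ H_t`. -/
def IsOptimalChoice (q : ℝ≥0∞) [Fact (1 ≤ q)] (γ : ℝ) (f : (Fin d → ℝ) → ℝ) (S : Set (Fin d → ℝ))
    {t : ℕ} (h : History m d t) (p : Fin m → ℝ) : Prop :=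
  p ∈ feasible q γ S h ∧ ∃ U ∈ confCube γ h,
    ∀ p' ∈ feasible q γ S h, ∀ U' ∈ confCube γ h, f (U'.mulVec p') ≤ f (U.mulVec p)

/-- `π` is an execution of the UCB algorithm over the horizon `T` with parameter `γ`: after every
history of fewer than `T` rounds it uses an optimal solution of the optimization problem over the
confidence hypercube if that problem is feasible, and an arbitrary distribution otherwise. -/
def IsUCBPolicy (q : ℝ≥0∞) [Fact (1 ≤ q)] (γ : ℝ) (f : (Fin d → ℝ) → ℝ) (S : Set (Fin d → ℝ))
    (T : ℕ) (π : Policy m d) : Prop :=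
  ∀ t < T, ∀ h : History m d t, (feasible q γ S h).Nonempty →
    IsOptimalChoice q γ f S h (π.dist t h)

end BwCR

end

/-!
A history of the bandit process is a trajectory of Markov kernels, so sums of bounded increments
along it are controlled through exponential supermartingales. A Chernoff bound whose exponent is
tuned to the number of plays, with a union bound over that number, puts the means into all the
confidence hypercubes; the Azuma-Hoeffding inequality keeps the sums of the interval widths and of
the observations within `√(γ T)` of their conditional means. Since the `k`-th play of an arm sees
an interval of length `O(√(γ / k))`, the widths along any history sum up to `O(√(γ m T))`.

On this event every distribution `p` with `V p` in the closure of `S` stays feasible, and for any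
choice of matrices `Uₜ` in the hypercubes the average of `Uₜ pₜ` is within `18 √(γ m / T)` of the
observed average in each component. Taking for `Uₜ` the optimistic matrices of the objective,
concavity gives the first bound; taking the matrices that witness feasibility, convexity of `S`
gives the second. The optimal value is at most that of the best such `p`, because for a policy
with average observation in `S` the expected average is `V p`, where `p` is the expected average
distribution over arms, and lies in the closure of `S`; Jensen's inequality does the rest.
-/

noncomputable section

namespace BwCR

open ProbabilityTheory
open scoped NNReal

section Trajectory

variable {α : Type*}

/-- The trajectory `h` before time `s`. -/
def past {T : ℕ} (h : Fin T → α) (s : Fin T) : Fin s → α := fun k => h (k.castLE s.isLt.le)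

lemma past_snoc_castSucc {t : ℕ} (h : Fin t → α) (a : α) (s : Fin t) :
    past (Fin.snoc h a : Fin (t + 1) → α) s.castSucc = past h s :=
  funext fun k => Fin.snoc_castSucc (α := fun _ => α) a h (k.castLE s.isLt.le)

lemma past_snoc_last {t : ℕ} (h : Fin t → α) (a : α) :
    past (Fin.snoc h a : Fin (t + 1) → α) (Fin.last t) = h :=
  funext fun k => Fin.snoc_castSucc (α := fun _ => α) a h k

/-- The sum along the trajectory `h` of the increments `g s (past h s) (h s)`, each of which depends
on the past and on the current entry. -/
def pathSum (g : (t : ℕ) → (Fin t → α) → α → ℝ) {t : ℕ} (h : Fin t → α) : ℝ :=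
  ∑ s : Fin t, g s (past h s) (h s)

lemma pathSum_snoc (g : (t : ℕ) → (Fin t → α) → α → ℝ) {t : ℕ} (h : Fin t → α) (a : α) :
    pathSum g (Fin.snoc h a : Fin (t + 1) → α) = pathSum g h + g t h a := by
  rw [pathSum, Fin.sum_univ_castSucc]
  simp only [past_snoc_castSucc, Fin.snoc_castSucc, Fin.snoc_last, Fin.val_castSucc, pathSum,
    past_snoc_last, Fin.val_last]

variable [MeasurableSpace α]

@[fun_prop]
lemma measurable_past {T : ℕ} (s : Fin T) : Measurable fun h : Fin T → α => past h s :=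
  measurable_pi_lambda _ fun _ => measurable_pi_apply _

@[fun_prop]
lemma measurable_snoc {t : ℕ} :
    Measurable fun z : (Fin t → α) × α => (Fin.snoc z.1 z.2 : Fin (t + 1) → α) := by
  refine measurable_pi_lambda _ fun s => ?_
  cases s using Fin.lastCases with
  | last => simpa only [Fin.snoc_last] using measurable_snd
  | cast s => simpa only [Fin.snoc_castSucc] using measurable_fst.eval

lemma measurable_pathSum {g : (t : ℕ) → (Fin t → α) → α → ℝ}
    (hg : ∀ t, Measurable (Function.uncurry (g t))) (t : ℕ) :
    Measurable fun h : Fin t → α => pathSum g h :=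
  Finset.measurable_fun_sum Finset.univ fun s _ =>
    (hg s).comp ((measurable_past s).prodMk (measurable_pi_apply s))

variable (κ : (t : ℕ) → Kernel (Fin t → α) α)

/-- The law of the first `t` entries of the process whose entry at time `s` is drawn from `κ s`,
given the past. -/
def trajLaw : (t : ℕ) → Measure (Fin t → α)
  | 0 => Measure.dirac fun s => s.elim0
  | t + 1 => (trajLaw t ⊗ₘ κ t).map fun z => Fin.snoc z.1 z.2

variable [∀ t, IsMarkovKernel (κ t)]

instance isProbabilityMeasure_trajLaw (t : ℕ) : IsProbabilityMeasure (trajLaw κ t) := by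
  induction t with
  | zero => exact Measure.dirac.isProbabilityMeasure
  | succ t _ => exact Measure.isProbabilityMeasure_map measurable_snoc.aemeasurable

lemma lintegral_trajLaw_succ {t : ℕ} {F : (Fin (t + 1) → α) → ℝ≥0∞} (hF : Measurable F) :
    ∫⁻ h, F h ∂trajLaw κ (t + 1) = ∫⁻ h, ∫⁻ a, F (Fin.snoc h a) ∂κ t h ∂trajLaw κ t := by
  rw [trajLaw, lintegral_map hF measurable_snoc]
  exact Measure.lintegral_compProd (hF.comp measurable_snoc)

lemma integral_trajLaw_succ {t : ℕ} {F : (Fin (t + 1) → α) → ℝ} (hF : Measurable F)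
    (hFi : Integrable F (trajLaw κ (t + 1))) :
    ∫ h, F h ∂trajLaw κ (t + 1) = ∫ h, ∫ a, F (Fin.snoc h a) ∂κ t h ∂trajLaw κ t := by
  rw [trajLaw] at hFi ⊢
  rw [integral_map measurable_snoc.aemeasurable hF.aestronglyMeasurable]
  exact Measure.integral_compProd (hFi.comp_measurable measurable_snoc)

lemma map_past_trajLaw {T : ℕ} (s : Fin T) :
    (trajLaw κ T).map (fun h => past h s) = trajLaw κ s := by
  induction T with
  | zero => exact s.elim0
  | succ T ih =>
    rw [trajLaw, Measure.map_map (measurable_past s) measurable_snoc]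
    cases s using Fin.lastCases with
    | last =>
      have : (fun h => past h (Fin.last T)) ∘ (fun z : (Fin T → α) × α => Fin.snoc z.1 z.2) =
          Prod.fst := funext fun z => past_snoc_last z.1 z.2
      rw [this]
      exact Measure.fst_compProd _ _
    | cast s =>
      have : (fun h => past h s.castSucc) ∘ (fun z : (Fin T → α) × α => Fin.snoc z.1 z.2) =
          (fun h => past h s) ∘ Prod.fst := funext fun z => past_snoc_castSucc z.1 z.2 s
      rw [this, ← Measure.map_map (measurable_past s) measurable_fst]
      exact (congrArg _ (Measure.fst_compProd _ _)).trans (ih s)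

end Trajectory

section Concentration

variable {α : Type*} [MeasurableSpace α] (κ : (t : ℕ) → Kernel (Fin t → α) α)
  [∀ t, IsMarkovKernel (κ t)] {g : (t : ℕ) → (Fin t → α) → α → ℝ}

lemma lintegral_exp_pathSum_le_one (hg : ∀ t, Measurable (Function.uncurry (g t)))
    (hexp : ∀ t h, ∫⁻ a, ENNReal.ofReal (Real.exp (g t h a)) ∂κ t h ≤ 1) (t : ℕ) :
    ∫⁻ h, ENNReal.ofReal (Real.exp (pathSum g h)) ∂trajLaw κ t ≤ 1 := by
  induction t with
  | zero => simp [pathSum]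
  | succ t ih =>
    rw [lintegral_trajLaw_succ κ (measurable_pathSum hg (t + 1)).exp.ennreal_ofReal]
    refine (lintegral_mono fun h => ?_).trans ih
    simp only [pathSum_snoc, Real.exp_add, ENNReal.ofReal_mul (Real.exp_pos _).le]
    refine (lintegral_const_mul _
      ((hg t).comp measurable_prodMk_left).exp.ennreal_ofReal).trans_le ?_
    exact mul_le_of_le_one_right' (hexp t h)

lemma trajLaw_le_pathSum_le (hg : ∀ t, Measurable (Function.uncurry (g t)))
    (hexp : ∀ t h, ∫⁻ a, ENNReal.ofReal (Real.exp (g t h a)) ∂κ t h ≤ 1) (t : ℕ) (a : ℝ) :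
    trajLaw κ t {h | a ≤ pathSum g h} ≤ ENNReal.ofReal (Real.exp (-a)) := by
  have hpos : ENNReal.ofReal (Real.exp a) ≠ 0 := by simp [Real.exp_pos]
  calc trajLaw κ t {h | a ≤ pathSum g h}
      = trajLaw κ t {h | ENNReal.ofReal (Real.exp a) ≤
          ENNReal.ofReal (Real.exp (pathSum g h))} := by
        simp only [ENNReal.ofReal_le_ofReal_iff (Real.exp_pos _).le, Real.exp_le_exp]
    _ ≤ (∫⁻ h, ENNReal.ofReal (Real.exp (pathSum g h)) ∂trajLaw κ t) /
          ENNReal.ofReal (Real.exp a) :=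
        meas_ge_le_lintegral_div (measurable_pathSum hg t).exp.ennreal_ofReal.aemeasurable hpos
          ENNReal.ofReal_ne_top
    _ ≤ 1 / ENNReal.ofReal (Real.exp a) := by
        gcongr
        exact lintegral_exp_pathSum_le_one κ hg hexp t
    _ = ENNReal.ofReal (Real.exp (-a)) := by
        rw [one_div, ← ENNReal.ofReal_inv_of_pos (Real.exp_pos a), Real.exp_neg]

lemma lintegral_exp_mul_sub_le_one {μ : Measure α} [IsProbabilityMeasure μ] {X : α → ℝ} {c : ℝ≥0}
    (hX : HasSubgaussianMGF X c μ) (r : ℝ) :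
    ∫⁻ a, ENNReal.ofReal (Real.exp (r * X a - c * r ^ 2 / 2)) ∂μ ≤ 1 := by
  simp only [Real.exp_sub, div_eq_mul_inv (Real.exp (r * _))]
  rw [← ofReal_integral_eq_lintegral_ofReal ((hX.integrable_exp_mul r).mul_const _)
    (ae_of_all _ fun _ => by positivity), integral_mul_const, ← div_eq_mul_inv,
    ENNReal.ofReal_le_one, div_le_one (Real.exp_pos _)]
  exact hX.mgf_le r

lemma azuma_hoeffding {c : ℝ≥0} (hg : ∀ t, Measurable (Function.uncurry (g t)))
    (hsub : ∀ t h, HasSubgaussianMGF (g t h) c (κ t h)) (t : ℕ) {ε : ℝ} (hε : 0 ≤ ε) :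
    trajLaw κ t {h | ε ≤ pathSum g h} ≤ ENNReal.ofReal (Real.exp (-(ε ^ 2 / (2 * t * c)))) := by
  set r : ℝ := ε / (t * c) with hr
  have hexponent : ε ^ 2 / (2 * t * c) = r * ε - t * (c * r ^ 2 / 2) := by
    rcases eq_or_ne (t * c : ℝ) 0 with h0 | _
    · simp [hr, h0, mul_assoc]
    · rw [hr]
      field_simp
      ring
  have hsum : ∀ h : Fin t → α, pathSum (fun t h a => r * g t h a - c * r ^ 2 / 2) h =
      r * pathSum g h - t * (c * r ^ 2 / 2) := fun h => by
    simp [pathSum, Finset.sum_sub_distrib, Finset.mul_sum]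
  refine le_trans (measure_mono fun h (hh : ε ≤ pathSum g h) => ?_)
    (trajLaw_le_pathSum_le κ (fun t => ((hg t).const_mul r).sub_const (c * r ^ 2 / 2))
      (fun t h => lintegral_exp_mul_sub_le_one (hsub t h) r) t (ε ^ 2 / (2 * t * c)))
  rw [Set.mem_ofPred_eq, hsum, hexponent]
  gcongr

lemma azuma_hoeffding_abs {c : ℝ≥0} (hg : ∀ t, Measurable (Function.uncurry (g t)))
    (hsub : ∀ t h, HasSubgaussianMGF (g t h) c (κ t h)) (t : ℕ) {ε : ℝ} (hε : 0 ≤ ε) :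
    trajLaw κ t {h | ε ≤ |pathSum g h|} ≤
      2 * ENNReal.ofReal (Real.exp (-(ε ^ 2 / (2 * t * c)))) := by
  have hneg : ∀ h : Fin t → α, pathSum (fun t h a => -g t h a) h = -pathSum g h := fun h =>
    Finset.sum_neg_distrib _
  have hlower := azuma_hoeffding κ (g := fun t h a => -g t h a) (fun t => (hg t).neg)
    (fun t h => (hsub t h).neg) t hε
  simp only [hneg] at hlower
  simp only [le_abs, Set.ofPred_or]
  rw [two_mul (ENNReal.ofReal _)]
  exact (measure_union_le _ _).trans (add_le_add (azuma_hoeffding κ hg hsub t hε) hlower)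

/-- The increments `g` centered by their conditional means. -/
def compensated (g : (t : ℕ) → (Fin t → α) → α → ℝ) (t : ℕ) (h : Fin t → α) (a : α) : ℝ :=
  g t h a - ∫ b, g t h b ∂κ t h

lemma measurable_compensated (hg : ∀ t, Measurable (Function.uncurry (g t))) (t : ℕ) :
    Measurable (Function.uncurry (compensated κ g t)) :=
  (hg t).sub (((hg t).stronglyMeasurable.integral_kernel_prod_right'
    (κ := κ t)).measurable.comp measurable_fst)

lemma hasSubgaussianMGF_compensated (hg : ∀ t, Measurable (Function.uncurry (g t)))
    (hg01 : ∀ t h a, g t h a ∈ Set.Icc (0 : ℝ) 1) (t : ℕ) (h : Fin t → α) :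
    HasSubgaussianMGF (compensated κ g t h) (1 / 4) (κ t h) := by
  have hparam : (1 / 4 : ℝ≥0) = (‖(1 : ℝ) - 0‖₊ / 2) ^ 2 := by
    rw [sub_zero, nnnorm_one]
    norm_num
  rw [hparam]
  exact hasSubgaussianMGF_of_mem_Icc ((hg t).comp measurable_prodMk_left).aemeasurable
    (ae_of_all (κ t h) (hg01 t h))

lemma trajLaw_sqrt_le_abs_pathSum_compensated_le (hg : ∀ t, Measurable (Function.uncurry (g t)))
    (hg01 : ∀ t h a, g t h a ∈ Set.Icc (0 : ℝ) 1) {γ : ℝ} (hγ : 0 ≤ γ) {t : ℕ} (ht : 0 < t) :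
    trajLaw κ t {h | √(γ * t) ≤ |pathSum (compensated κ g) h|} ≤
      2 * ENNReal.ofReal (Real.exp (-(2 * γ))) := by
  refine (azuma_hoeffding_abs κ (measurable_compensated κ hg)
    (hasSubgaussianMGF_compensated κ hg hg01) t (Real.sqrt_nonneg _)).trans_eq ?_
  have hexponent : γ * t / (2 * t * ((1 / 4 : ℝ≥0) : ℝ)) = 2 * γ := by
    push_cast
    field_simp
    norm_num
  rw [Real.sq_sqrt (by positivity), hexponent]

lemma integral_compensated (hg : ∀ t, Measurable (Function.uncurry (g t)))
    (hg01 : ∀ t h a, g t h a ∈ Set.Icc (0 : ℝ) 1) (t : ℕ) (h : Fin t → α) :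
    ∫ a, compensated κ g t h a ∂κ t h = 0 := by
  have hint : Integrable (g t h) (κ t h) := Integrable.of_mem_Icc 0 1
    ((hg t).comp measurable_prodMk_left).aemeasurable (ae_of_all _ (hg01 t h))
  simp [compensated, integral_sub hint (integrable_const _)]

lemma abs_compensated_le_one (hg01 : ∀ t h a, g t h a ∈ Set.Icc (0 : ℝ) 1) (t : ℕ)
    (h : Fin t → α) (a : α) : |compensated κ g t h a| ≤ 1 := by
  have hmean : ‖∫ b, g t h b ∂κ t h‖ ≤ 1 := by
    simpa using norm_integral_le_of_norm_le_const (ae_of_all (κ t h) fun b =>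
      (Real.norm_of_nonneg (hg01 t h b).1).trans_le (hg01 t h b).2)
  exact abs_sub_le_of_nonneg_of_le (hg01 t h a).1 (hg01 t h a).2
    (integral_nonneg fun b => (hg01 t h b).1) ((Real.le_norm_self _).trans hmean)

lemma integrable_pathSum_compensated (hg : ∀ t, Measurable (Function.uncurry (g t)))
    (hg01 : ∀ t h a, g t h a ∈ Set.Icc (0 : ℝ) 1) (t : ℕ) :
    Integrable (fun h => pathSum (compensated κ g) h) (trajLaw κ t) := by
  refine Integrable.of_bound
    (measurable_pathSum (measurable_compensated κ hg) t).aestronglyMeasurable t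
    (ae_of_all _ fun h => ?_)
  calc ‖pathSum (compensated κ g) h‖ ≤ ∑ _s : Fin t, (1 : ℝ) :=
        norm_sum_le_of_le Finset.univ fun s _ => abs_compensated_le_one κ hg01 s _ _
    _ = t := by simp

lemma integral_pathSum_compensated (hg : ∀ t, Measurable (Function.uncurry (g t)))
    (hg01 : ∀ t h a, g t h a ∈ Set.Icc (0 : ℝ) 1) (t : ℕ) :
    ∫ h, pathSum (compensated κ g) h ∂trajLaw κ t = 0 := by
  induction t with
  | zero => simp [pathSum]
  | succ t ih =>
    rw [integral_trajLaw_succ κ (measurable_pathSum (measurable_compensated κ hg) _)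
      (integrable_pathSum_compensated κ hg hg01 _), ← ih]
    refine integral_congr_ae (ae_of_all _ fun h => ?_)
    have hint := (hasSubgaussianMGF_compensated κ hg hg01 t h).integrable
    simp only [pathSum_snoc, integral_add (integrable_const _) hint,
      integral_compensated κ hg hg01, integral_const, probReal_univ, one_smul, add_zero]

end Concentration

variable {m d : ℕ}

section Bandit

variable (D : Fin m → Measure (Obs d)) (π : Policy m d)

/-- One round of the bandit process as a kernel from the past to the pair of the arm and the
observation, so that the histories become the trajectories of these kernels. -/
def roundKernel (t : ℕ) : Kernel (History m d t) (Fin m × Obs d) where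
  toFun h := ∑ i, ENNReal.ofReal (π.dist t h i) • (D i).map (Prod.mk i)
  measurable' := by
    refine Measure.measurable_of_measurable_coe _ fun s _ => ?_
    simp only [Measure.finsetSum_apply, Measure.smul_apply, smul_eq_mul]
    exact Finset.measurable_fun_sum _ fun i _ =>
      (π.measurable_dist t).eval.ennreal_ofReal.mul_const _

lemma roundKernel_apply (t : ℕ) (h : History m d t) :
    roundKernel D π t h = ∑ i, ENNReal.ofReal (π.dist t h i) • (D i).map (Prod.mk i) :=
  rfl

lemma lintegral_roundKernel {t : ℕ} (h : History m d t) {F : Fin m × Obs d → ℝ≥0∞}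
    (hF : Measurable F) :
    ∫⁻ a, F a ∂roundKernel D π t h =
      ∑ i, ENNReal.ofReal (π.dist t h i) * ∫⁻ x, F (i, x) ∂D i := by
  simp only [roundKernel_apply, lintegral_finsetSum_measure, lintegral_smul_measure, smul_eq_mul,
    lintegral_map hF measurable_prodMk_left]

lemma integral_roundKernel {t : ℕ} (h : History m d t) {F : Fin m × Obs d → ℝ}
    (hF : Measurable F) (hFi : ∀ i, Integrable (fun x => F (i, x)) (D i)) :
    ∫ a, F a ∂roundKernel D π t h = ∑ i, π.dist t h i * ∫ x, F (i, x) ∂D i := by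
  have hmap : ∀ i, Integrable F ((D i).map (Prod.mk i)) := fun i =>
    (integrable_map_measure hF.aestronglyMeasurable measurable_prodMk_left.aemeasurable).2 (hFi i)
  rw [roundKernel_apply, integral_finsetSum_measure fun i _ =>
    (hmap i).smul_measure ENNReal.ofReal_ne_top]
  refine Finset.sum_congr rfl fun i _ => ?_
  rw [integral_smul_measure, ENNReal.toReal_ofReal ((π.mem_simplex t h).1 i), smul_eq_mul,
    integral_map measurable_prodMk_left.aemeasurable hF.aestronglyMeasurable]

lemma sum_ofReal_dist {t : ℕ} (h : History m d t) :
    ∑ i, ENNReal.ofReal (π.dist t h i) = 1 := by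
  rw [← ENNReal.ofReal_sum_of_nonneg fun i _ => (π.mem_simplex t h).1 i, (π.mem_simplex t h).2,
    ENNReal.ofReal_one]

variable [∀ i, IsProbabilityMeasure (D i)]

instance isMarkovKernel_roundKernel (t : ℕ) : IsMarkovKernel (roundKernel D π t) := by
  refine ⟨fun h => ⟨?_⟩⟩
  rw [← lintegral_one, lintegral_roundKernel D π h measurable_const]
  simp [sum_ofReal_dist]

lemma lintegral_histLaw_succ {t : ℕ} {F : History m d (t + 1) → ℝ≥0∞} (hF : Measurable F) :
    ∫⁻ h, F h ∂histLaw D π (t + 1) =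
      ∫⁻ h, ∫⁻ a, F (Fin.snoc h a) ∂roundKernel D π t h ∂histLaw D π t := by
  have hd : ∀ i, Measurable fun h => ENNReal.ofReal (π.dist t h i) := fun i =>
    (π.measurable_dist t).eval.ennreal_ofReal
  have hsnoc : ∀ i, Measurable fun z : History m d t × Obs d =>
      (Fin.snoc z.1 (i, z.2) : History m d (t + 1)) := fun i =>
    measurable_snoc.comp (measurable_fst.prodMk (measurable_const.prodMk measurable_snd))
  have hlint : ∀ i, Measurable fun h : History m d t => ∫⁻ x, F (Fin.snoc h (i, x)) ∂D i :=
    fun i => (hF.comp (hsnoc i)).lintegral_prod_right'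
  have hround : ∀ h : History m d t, ∫⁻ a, F (Fin.snoc h a) ∂roundKernel D π t h =
      ∑ i, ENNReal.ofReal (π.dist t h i) * ∫⁻ x, F (Fin.snoc h (i, x)) ∂D i := fun h =>
    lintegral_roundKernel D π h (hF.comp (measurable_snoc.comp measurable_prodMk_left))
  simp only [hround]
  rw [lintegral_finsetSum _ fun i _ => (hd i).fun_mul (hlint i), histLaw,
    lintegral_finsetSum_measure]
  refine Finset.sum_congr rfl fun i _ => ?_
  rw [lintegral_map hF (hsnoc i)]
  exact (lintegral_prod _ (hF.comp (hsnoc i)).aemeasurable).trans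
    (lintegral_withDensity_eq_lintegral_mul _ (hd i) (hlint i))

lemma histLaw_eq_trajLaw (t : ℕ) : histLaw D π t = trajLaw (roundKernel D π) t := by
  induction t with
  | zero => rfl
  | succ t ih =>
    refine Measure.ext_of_lintegral _ fun F hF => ?_
    rw [lintegral_histLaw_succ D π hF, lintegral_trajLaw_succ _ hF, ih]

instance isProbabilityMeasure_histLaw (t : ℕ) : IsProbabilityMeasure (histLaw D π t) :=
  histLaw_eq_trajLaw D π t ▸ inferInstance

lemma histLaw_preimage_past_le {T : ℕ} (s : Fin T) (A : Set (History m d s)) :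
    histLaw D π T {h | past h s ∈ A} ≤ histLaw D π s A := by
  rw [histLaw_eq_trajLaw, histLaw_eq_trajLaw, ← map_past_trajLaw (roundKernel D π) s]
  exact Measure.le_map_apply (measurable_past s).aemeasurable A

end Bandit

section ConfidenceIntervals

lemma exp_mul_le_of_mem_Icc {y : ℝ} (hy : y ∈ Set.Icc (0 : ℝ) 1) (r : ℝ) :
    Real.exp (r * y) ≤ 1 + (Real.exp r - 1) * y := by
  have h := convexOn_exp.2 (Set.mem_univ 0) (Set.mem_univ r) (sub_nonneg.2 hy.2) hy.1
    (sub_add_cancel 1 y)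
  simp only [smul_eq_mul, mul_zero, zero_add, Real.exp_zero, mul_one] at h
  rw [mul_comm r y]
  linarith

lemma lintegral_exp_mul_sub_exp_sub_one_mul_le_one {Ω : Type*} [MeasurableSpace Ω]
    {μ : Measure Ω} [IsProbabilityMeasure μ] {X : Ω → ℝ} (hX : Measurable X)
    (hX01 : ∀ ω, X ω ∈ Set.Icc (0 : ℝ) 1) (r : ℝ) :
    ∫⁻ ω, ENNReal.ofReal (Real.exp (r * X ω - (Real.exp r - 1) * ∫ ω, X ω ∂μ)) ∂μ ≤ 1 := by
  set c : ℝ := (Real.exp r - 1) * ∫ ω, X ω ∂μ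
  have hint : Integrable X μ := Integrable.of_mem_Icc 0 1 hX.aemeasurable (ae_of_all _ hX01)
  have hint' : Integrable (fun ω => 1 + (Real.exp r - 1) * X ω) μ :=
    (integrable_const 1).add (hint.const_mul _)
  have hlin : ∀ ω, Real.exp (r * X ω) ≤ 1 + (Real.exp r - 1) * X ω := fun ω =>
    exp_mul_le_of_mem_Icc (hX01 ω) r
  calc ∫⁻ ω, ENNReal.ofReal (Real.exp (r * X ω - c)) ∂μ
      ≤ ∫⁻ ω, ENNReal.ofReal ((1 + (Real.exp r - 1) * X ω) * Real.exp (-c)) ∂μ := by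
        refine lintegral_mono fun ω => ENNReal.ofReal_le_ofReal ?_
        rw [sub_eq_add_neg, Real.exp_add]
        exact mul_le_mul_of_nonneg_right (hlin ω) (Real.exp_pos _).le
    _ = ENNReal.ofReal ((1 + c) * Real.exp (-c)) := by
        rw [← ofReal_integral_eq_lintegral_ofReal (hint'.mul_const _) (ae_of_all _ fun ω =>
            mul_nonneg ((Real.exp_pos _).le.trans (hlin ω)) (Real.exp_pos _).le),
          integral_mul_const, integral_add (integrable_const 1) (hint.const_mul _),
          integral_const_mul, integral_const, probReal_univ, one_smul]
    _ ≤ ENNReal.ofReal (Real.exp c * Real.exp (-c)) := by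
        gcongr
        rw [add_comm]
        exact Real.add_one_le_exp c
    _ = 1 := by rw [← Real.exp_add, add_neg_cancel, Real.exp_zero, ENNReal.ofReal_one]

/-- The sum of component `j` of the vectors observed in the plays of arm `i`. -/
def armSum {t : ℕ} (h : History m d t) (j : Fin d) (i : Fin m) : ℝ :=
  ∑ s with (h s).1 = i, ((h s).2 j : ℝ)

lemma armSum_nonneg {t : ℕ} (h : History m d t) (j : Fin d) (i : Fin m) : 0 ≤ armSum h j i :=
  Finset.sum_nonneg fun s _ => ((h s).2 j).2.1

lemma armSum_le_plays {t : ℕ} (h : History m d t) (j : Fin d) (i : Fin m) :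
    armSum h j i ≤ plays h i := by
  simpa [armSum, plays] using Finset.sum_le_card_nsmul (Finset.univ.filter (fun s => (h s).1 = i))
    (fun s => ((h s).2 j : ℝ)) 1 fun s _ => ((h s).2 j).2.2

lemma plays_le {t : ℕ} (h : History m d t) (i : Fin m) : plays h i ≤ t :=
  (Finset.card_le_univ _).trans_eq (Fintype.card_fin t)

@[fun_prop]
lemma measurable_obs_apply (j : Fin d) : Measurable fun x : Obs d => (x j : ℝ) :=
  measurable_subtype_coe.comp (measurable_pi_apply j)

variable (D : Fin m → Measure (Obs d)) [∀ i, IsProbabilityMeasure (D i)] (π : Policy m d)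

lemma integrable_obs (j : Fin d) (i : Fin m) : Integrable (fun x : Obs d => (x j : ℝ)) (D i) :=
  Integrable.of_mem_Icc 0 1 (measurable_obs_apply j).aemeasurable (ae_of_all _ fun x => (x j).2)

lemma meanMatrix_mem_Icc (j : Fin d) (i : Fin m) : meanMatrix D j i ∈ Set.Icc (0 : ℝ) 1 :=
  ⟨integral_nonneg fun x => (x j).2.1, (integral_mono (integrable_obs D j i)
    (integrable_const 1) fun x => (x j).2.2).trans_eq (by simp)⟩

lemma histLaw_le_mul_armSum_sub_le (j : Fin d) (i : Fin m) (r a : ℝ) (t : ℕ) :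
    histLaw D π t {h | a ≤ r * armSum h j i -
      (Real.exp r - 1) * (plays h i * meanMatrix D j i)} ≤ ENNReal.ofReal (Real.exp (-a)) := by
  let φ : Fin m × Obs d → ℝ := fun a =>
    if a.1 = i then r * a.2 j - (Real.exp r - 1) * meanMatrix D j i else 0
  have hφ : Measurable φ := Measurable.ite (measurable_fst (measurableSet_singleton i))
    (by fun_prop) measurable_const
  have hsum : ∀ h : History m d t, pathSum (fun _ _ a => φ a) h =
      r * armSum h j i - (Real.exp r - 1) * (plays h i * meanMatrix D j i) := fun h => by
    simp only [pathSum, φ, armSum, plays, ← Finset.sum_filter, Finset.sum_sub_distrib,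
      ← Finset.mul_sum, Finset.sum_const, nsmul_eq_mul]
  have hstep : ∀ (t : ℕ) (h : History m d t),
      ∫⁻ a, ENNReal.ofReal (Real.exp (φ a)) ∂roundKernel D π t h ≤ 1 := fun t h => by
    rw [lintegral_roundKernel D π h hφ.exp.ennreal_ofReal, ← sum_ofReal_dist π h]
    refine Finset.sum_le_sum fun i' _ => mul_le_of_le_one_right' ?_
    by_cases hi : i' = i
    · simp only [φ, hi, if_true]
      exact lintegral_exp_mul_sub_exp_sub_one_mul_le_one (measurable_obs_apply j)
        (fun x => (x j).2) r
    · simp [φ, hi]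
  simp only [← hsum, histLaw_eq_trajLaw]
  exact trajLaw_le_pathSum_le (roundKernel D π) (g := fun _ _ a => φ a)
    (fun t => hφ.comp measurable_snd) hstep t a

/-- The exponent `s` that makes the Chernoff bound give a Bernstein-type deviation: `s` is
`√(a / μ)`, truncated at `1`. -/
lemma exists_sq_mul_add_le {a μ : ℝ} (ha : 0 < a) (hμ : 0 ≤ μ) :
    ∃ s : ℝ, 0 < s ∧ s ≤ 1 ∧ s ^ 2 * μ + a ≤ s * (2 * √(a * μ) + a) := by
  rcases le_total μ a with h | h
  · refine ⟨1, one_pos, le_rfl, ?_⟩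
    have : μ ≤ √(a * μ) := Real.le_sqrt_of_sq_le (by nlinarith)
    nlinarith [Real.sqrt_nonneg (a * μ)]
  · have hμ' : 0 < μ := ha.trans_le h
    refine ⟨√(a / μ), by positivity, Real.sqrt_le_one.2 ((div_le_one hμ').2 h), ?_⟩
    have hprod : √(a / μ) * √(a * μ) = a := by
      rw [← Real.sqrt_mul (by positivity), show a / μ * (a * μ) = a ^ 2 by field_simp,
        Real.sqrt_sq ha.le]
    have hsq : √(a / μ) ^ 2 * μ = a := by
      rw [Real.sq_sqrt (by positivity), div_mul_cancel₀ _ hμ'.ne']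
    nlinarith [mul_nonneg (Real.sqrt_nonneg (a / μ)) ha.le]

lemma exp_sub_one_le_add_sq {r : ℝ} (hr : |r| ≤ 1) : Real.exp r - 1 ≤ r + r ^ 2 := by
  linarith [le_abs_self (Real.exp r - 1 - r), Real.abs_exp_sub_one_sub_id_le hr]

lemma le_or_le_of_deviation_lt {a μ s X : ℝ} (hμ : 0 ≤ μ) (hs0 : 0 < s) (hs1 : s ≤ 1)
    (hs : s ^ 2 * μ + a ≤ s * (2 * √(a * μ) + a)) (hX : 2 * √(a * μ) + a < |X - μ|) :
    a ≤ s * X - (Real.exp s - 1) * μ ∨ a ≤ -s * X - (Real.exp (-s) - 1) * μ := by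
  have hs' : |s| ≤ 1 := abs_le.2 ⟨by linarith, hs1⟩
  have hmul : s * (2 * √(a * μ) + a) ≤ s * |X - μ| := mul_le_mul_of_nonneg_left hX.le hs0.le
  have hpos := mul_le_mul_of_nonneg_right (exp_sub_one_le_add_sq hs') hμ
  have hneg := mul_le_mul_of_nonneg_right (exp_sub_one_le_add_sq ((abs_neg s).trans_le hs')) hμ
  rcases abs_choice (X - μ) with h | h <;> rw [h] at hmul
  · left
    nlinarith
  · right
    nlinarith

lemma histLaw_lt_abs_armSum_sub_le (j : Fin d) (i : Fin m) {a : ℝ} (ha : 0 < a) (t : ℕ) :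
    histLaw D π t {h | 2 * √(a * (plays h i * meanMatrix D j i)) + a <
      |armSum h j i - plays h i * meanMatrix D j i|} ≤
        (t + 1) * (2 * ENNReal.ofReal (Real.exp (-a))) := by
  have hμ : ∀ k : ℕ, 0 ≤ k * meanMatrix D j i := fun k =>
    mul_nonneg k.cast_nonneg (meanMatrix_mem_Icc D j i).1
  choose s hs0 hs1 hs using fun k : ℕ => exists_sq_mul_add_le ha (hμ k)
  let E : ℝ → Set (History m d t) := fun r =>
    {h | a ≤ r * armSum h j i - (Real.exp r - 1) * (plays h i * meanMatrix D j i)}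
  have hE : ∀ r, histLaw D π t (E r) ≤ ENNReal.ofReal (Real.exp (-a)) := fun r =>
    histLaw_le_mul_armSum_sub_le D π j i r a t
  calc histLaw D π t {h | 2 * √(a * (plays h i * meanMatrix D j i)) + a <
        |armSum h j i - plays h i * meanMatrix D j i|}
      ≤ histLaw D π t (⋃ k ∈ Finset.range (t + 1), (E (s k) ∪ E (-s k))) := by
        refine measure_mono fun h hh => Set.mem_iUnion₂.2 ⟨plays h i,
          Finset.mem_range_succ_iff.2 (plays_le h i), ?_⟩
        exact le_or_le_of_deviation_lt (hμ _) (hs0 _) (hs1 _) (hs _) hh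
    _ ≤ ∑ k ∈ Finset.range (t + 1), histLaw D π t (E (s k) ∪ E (-s k)) :=
        measure_biUnion_finset_le _ _
    _ ≤ ∑ _k ∈ Finset.range (t + 1), 2 * ENNReal.ofReal (Real.exp (-a)) := by
        refine Finset.sum_le_sum fun k _ => (measure_union_le _ _).trans ?_
        rw [two_mul]
        exact add_le_add (hE _) (hE _)
    _ = (t + 1) * (2 * ENNReal.ofReal (Real.exp (-a))) := by simp

lemma two_sqrt_mul_add_le {a μ X : ℝ} (ha : 0 ≤ a) (hμ : 0 ≤ μ) (hX : 0 ≤ X)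
    (h : |X - μ| ≤ 2 * √(a * μ) + a) : |X - μ| ≤ 2 * √(a * X) + 6 * a := by
  refine h.trans ?_
  have hle := (neg_le_abs _).trans h
  rw [Real.sqrt_mul ha] at hle ⊢
  rw [Real.sqrt_mul ha]
  have hα := Real.sqrt_nonneg a
  have hx := Real.sqrt_nonneg X
  have hroot : √μ ≤ √X + 5 / 2 * √a := by
    by_contra! hlt
    nlinarith [Real.sq_sqrt ha, Real.sq_sqrt hμ, Real.sq_sqrt hX, mul_nonneg hα hx]
  nlinarith [Real.sq_sqrt ha, mul_le_mul_of_nonneg_left hroot hα]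

lemma mem_Icc_lcb_ucb {γ : ℝ} (hγ : 0 ≤ γ) {t : ℕ} (h : History m d t) (j : Fin d) (i : Fin m)
    {v : ℝ} (hv : v ∈ Set.Icc (0 : ℝ) 1)
    (hdev : |armSum h j i - (plays h i + 1) * v| ≤ 2 * (√(γ * armSum h j i) + γ)) :
    v ∈ Set.Icc (lcb γ h j i) (ucb γ h j i) := by
  have hN : (0 : ℝ) < plays h i + 1 := by positivity
  have hemp : empMean h j i = armSum h j i / (plays h i + 1) := rfl
  have hrad : rad γ (empMean h j i) (plays h i + 1) =
      (√(γ * armSum h j i) + γ) / (plays h i + 1) := by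
    rw [rad, hemp, mul_div_assoc', div_div, ← sq,
      Real.sqrt_div (mul_nonneg hγ (armSum_nonneg h j i)), Real.sqrt_sq hN.le, add_div]
  rw [abs_le] at hdev
  refine ⟨max_le hv.1 ?_, le_min hv.2 ?_⟩
  · rw [hrad, hemp, mul_div_assoc', ← sub_div, div_le_iff₀ hN]
    linarith
  · rw [hrad, hemp, mul_div_assoc', ← add_div, le_div_iff₀ hN]
    linarith

lemma meanMatrix_mem_Icc_lcb_ucb {γ : ℝ} (hγ : 2 ≤ γ) {t : ℕ} (h : History m d t) (j : Fin d)
    (i : Fin m) (hdev : |armSum h j i - plays h i * meanMatrix D j i| ≤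
      2 * √(γ / 4 * (plays h i * meanMatrix D j i)) + γ / 4) :
    meanMatrix D j i ∈ Set.Icc (lcb γ h j i) (ucb γ h j i) := by
  have hv := meanMatrix_mem_Icc D j i
  refine mem_Icc_lcb_ucb (by linarith) h j i hv ?_
  have hsqrt : 2 * √(γ / 4 * armSum h j i) = √(γ * armSum h j i) := by
    rw [div_mul_eq_mul_div, Real.sqrt_div' _ (by norm_num), show (4 : ℝ) = 2 ^ 2 by norm_num,
      Real.sqrt_sq zero_le_two, mul_div_cancel₀ _ two_ne_zero]
  have hinv := two_sqrt_mul_add_le (by linarith) (mul_nonneg (Nat.cast_nonneg _) hv.1)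
    (armSum_nonneg h j i) hdev
  rw [hsqrt] at hinv
  have hsqrt0 := Real.sqrt_nonneg (γ * armSum h j i)
  rw [add_one_mul, ← sub_sub]
  calc |armSum h j i - plays h i * meanMatrix D j i - meanMatrix D j i|
      ≤ |armSum h j i - plays h i * meanMatrix D j i| + |meanMatrix D j i| := abs_sub _ _
    _ ≤ (√(γ * armSum h j i) + 6 * (γ / 4)) + 1 := by
        rw [abs_of_nonneg hv.1]
        exact add_le_add hinv hv.2
    _ ≤ 2 * (√(γ * armSum h j i) + γ) := by linarith

lemma histLaw_meanMatrix_notMem_confCube_le {γ : ℝ} (hγ : 2 ≤ γ) (t : ℕ) :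
    histLaw D π t {h | meanMatrix D ∉ confCube γ h} ≤
      d * (m * ((t + 1) * (2 * ENNReal.ofReal (Real.exp (-(γ / 4)))))) := by
  calc histLaw D π t {h | meanMatrix D ∉ confCube γ h}
      ≤ histLaw D π t (⋃ (j : Fin d) (i : Fin m),
          {h | 2 * √(γ / 4 * (plays h i * meanMatrix D j i)) + γ / 4 <
            |armSum h j i - plays h i * meanMatrix D j i|}) := by
        refine measure_mono fun h hh => ?_
        contrapose! hh
        simp only [Set.mem_iUnion, Set.mem_ofPred_eq, not_exists, not_lt] at hh
        exact not_not.2 fun j i => meanMatrix_mem_Icc_lcb_ucb D hγ h j i (hh j i)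
    _ ≤ ∑ j : Fin d, ∑ i : Fin m, (t + 1) * (2 * ENNReal.ofReal (Real.exp (-(γ / 4)))) := by
        refine (measure_iUnion_fintype_le _ _).trans (Finset.sum_le_sum fun j _ => ?_)
        refine (measure_iUnion_fintype_le _ _).trans (Finset.sum_le_sum fun i _ => ?_)
        exact histLaw_lt_abs_armSum_sub_le D π j i (by linarith) t
    _ = d * (m * ((t + 1) * (2 * ENNReal.ofReal (Real.exp (-(γ / 4)))))) := by simp

end ConfidenceIntervals

section Widths

lemma plays_snoc {t : ℕ} (h : History m d t) (a : Fin m × Obs d) (i : Fin m) :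
    plays (Fin.snoc h a : History m d (t + 1)) i = plays h i + if a.1 = i then 1 else 0 := by
  simp only [plays, Finset.card_filter, Fin.sum_univ_castSucc, Fin.snoc_castSucc, Fin.snoc_last]

lemma sum_plays {t : ℕ} (h : History m d t) : ∑ i, plays h i = t := by
  simp only [plays, Finset.card_filter]
  rw [Finset.sum_comm]
  simp

lemma measurable_plays {t : ℕ} (i : Fin m) :
    Measurable fun h : History m d t => (plays h i : ℝ) := by
  simp only [plays, Finset.card_filter, Nat.cast_sum]
  exact Finset.measurable_fun_sum _ fun s _ =>
    (measurable_of_finite fun i' : Fin m => ((if i' = i then 1 else 0 : ℕ) : ℝ)).comp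
      (measurable_pi_apply s).fst

lemma pathSum_comp_plays (φ : ℕ → ℝ) {t : ℕ} (h : History m d t) :
    pathSum (fun _ h a => φ (plays h a.1)) h = ∑ i, ∑ k ∈ Finset.range (plays h i), φ k := by
  induction h using Fin.snocInduction with
  | elim0 => simp [pathSum, plays]
  | snoc h a ih =>
    have hsplit : ∀ i, ∑ k ∈ Finset.range (plays h i + if a.1 = i then 1 else 0), φ k =
        ∑ k ∈ Finset.range (plays h i), φ k + if a.1 = i then φ (plays h i) else 0 := fun i => by
      split_ifs <;> simp [Finset.sum_range_succ]
    simp only [pathSum_snoc, ih, plays_snoc, hsplit, Finset.sum_add_distrib, Finset.sum_ite_eq,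
      Finset.mem_univ, if_true]

lemma sum_range_inv_sqrt_succ_le (n : ℕ) :
    ∑ k ∈ Finset.range n, (√((k : ℝ) + 1))⁻¹ ≤ 2 * √n := by
  induction n with
  | zero => simp
  | succ n ih =>
    rw [Finset.sum_range_succ]
    push_cast
    have hstep : (√((n : ℝ) + 1))⁻¹ ≤ 2 * (√((n : ℝ) + 1) - √n) := by
      rw [inv_le_iff_one_le_mul₀ (by positivity)]
      nlinarith [Real.sq_sqrt n.cast_nonneg, Real.sq_sqrt (n.cast_add_one_pos (α := ℝ)).le,
        sq_nonneg (√((n : ℝ) + 1) - √n)]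
    linarith

/-- An upper bound, common to all components, for the length of the confidence interval of an
arm. -/
def width (γ : ℝ) {t : ℕ} (h : History m d t) (i : Fin m) : ℝ :=
  min 1 (8 * √(γ / (plays h i + 1)))

lemma width_mem_Icc (γ : ℝ) {t : ℕ} (h : History m d t) (i : Fin m) :
    width γ h i ∈ Set.Icc (0 : ℝ) 1 :=
  ⟨le_min zero_le_one (by positivity), min_le_left _ _⟩

lemma measurable_width (γ : ℝ) {t : ℕ} :
    Measurable fun z : History m d t × (Fin m × Obs d) => width γ z.1 z.2.1 := by
  have hw : ∀ i, Measurable fun h : History m d t => width γ h i := fun i =>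
    measurable_const.min
      ((measurable_const.div ((measurable_plays i).add_const 1)).sqrt.const_mul 8)
  have huncurry : Measurable fun z : History m d t × Fin m => width γ z.1 z.2 :=
    measurable_from_prod_countable_left hw
  have harm : Measurable fun z : History m d t × (Fin m × Obs d) => (z.1, z.2.1) :=
    measurable_fst.prodMk measurable_snd.fst
  exact (huncurry.comp harm :)

lemma empMean_le_one {t : ℕ} (h : History m d t) (j : Fin d) (i : Fin m) :
    empMean h j i ≤ 1 :=
  div_le_one_of_le₀ ((armSum_le_plays h j i).trans (by linarith)) (by positivity)

lemma ucb_sub_lcb_le_width {γ : ℝ} (hγ : 0 ≤ γ) {t : ℕ} (h : History m d t) (j : Fin d)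
    (i : Fin m) : ucb γ h j i - lcb γ h j i ≤ width γ h i := by
  set N : ℝ := plays h i + 1
  have hle_one : ucb γ h j i - lcb γ h j i ≤ 1 :=
    (sub_le_sub (min_le_left _ _) (le_max_left _ _)).trans_eq (sub_zero 1)
  have hle_rad : ucb γ h j i - lcb γ h j i ≤ 4 * rad γ (empMean h j i) N :=
    (sub_le_sub (min_le_right _ _) (le_max_right _ _)).trans_eq (by ring)
  refine le_min hle_one ?_
  rcases le_total (γ / N) 1 with hsmall | hlarge
  · have hsqrt : √(γ * empMean h j i / N) ≤ √(γ / N) :=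
      Real.sqrt_le_sqrt (by gcongr; exact mul_le_of_le_one_right hγ (empMean_le_one h j i))
    have hratio : 0 ≤ γ / N := by positivity
    have hlin : γ / N ≤ √(γ / N) := Real.le_sqrt_of_sq_le (by nlinarith)
    rw [rad] at hle_rad
    linarith
  · linarith [Real.one_le_sqrt.2 hlarge]

lemma abs_sub_le_width {γ : ℝ} (hγ : 0 ≤ γ) {t : ℕ} {h : History m d t}
    {U V : Matrix (Fin d) (Fin m) ℝ} (hU : U ∈ confCube γ h) (hV : V ∈ confCube γ h)
    (j : Fin d) (i : Fin m) : |U j i - V j i| ≤ width γ h i :=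
  (abs_sub_le_of_le_of_le (hU j i).1 (hU j i).2 (hV j i).1 (hV j i).2).trans
    (ucb_sub_lcb_le_width hγ h j i)

lemma sum_sqrt_plays_le {t : ℕ} (h : History m d t) : ∑ i, √(plays h i) ≤ √(m * t) := by
  refine Real.le_sqrt_of_sq_le ?_
  have hcs := sq_sum_le_card_mul_sum_sq (s := Finset.univ) (f := fun i => √(plays h i))
  simp only [Real.sq_sqrt (Nat.cast_nonneg _), Finset.card_univ, Fintype.card_fin] at hcs
  rwa [← Nat.cast_sum, sum_plays h] at hcs

lemma pathSum_width_le {γ : ℝ} (hγ : 0 ≤ γ) {T : ℕ} (h : History m d T) :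
    pathSum (fun _ h a => width γ h a.1) h ≤ 16 * √(γ * m * T) := by
  have hwidth : ∀ k : ℕ, min 1 (8 * √(γ / (k + 1))) ≤ 8 * √γ * (√((k : ℝ) + 1))⁻¹ := fun k => by
    rw [mul_assoc, ← div_eq_mul_inv, ← Real.sqrt_div hγ]
    exact min_le_right _ _
  calc pathSum (fun _ h a => width γ h a.1) h
      = ∑ i, ∑ k ∈ Finset.range (plays h i), min 1 (8 * √(γ / (k + 1))) :=
        pathSum_comp_plays (fun k => min 1 (8 * √(γ / (k + 1)))) h
    _ ≤ ∑ i, 8 * √γ * (2 * √(plays h i)) := by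
        refine Finset.sum_le_sum fun i _ => (Finset.sum_le_sum fun k _ => hwidth k).trans ?_
        rw [← Finset.mul_sum]
        gcongr
        exact sum_range_inv_sqrt_succ_le _
    _ = 16 * √γ * ∑ i, √(plays h i) := by
        rw [← Finset.mul_sum, ← Finset.mul_sum]
        ring
    _ ≤ 16 * √γ * √(m * T) := by
        gcongr
        exact sum_sqrt_plays_le h
    _ = 16 * √(γ * m * T) := by rw [mul_assoc, ← Real.sqrt_mul hγ, mul_assoc γ]

end Widths

section TypicalHistories

variable {T : ℕ} (D : Fin m → Measure (Obs d)) (π : Policy m d)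

/-- The event of high probability on which the regret bounds hold: the means lie in all the
confidence hypercubes, and the widths and the observations sum up to about their conditional
means. -/
structure IsTypical (γ : ℝ) (h : History m d T) : Prop where
  mem_confCube : ∀ s, meanMatrix D ∈ confCube γ (past h s)
  abs_pathSum_width_lt :
    |pathSum (compensated (roundKernel D π) fun _ h a => width γ h a.1) h| < √(γ * T)
  abs_pathSum_obs_lt :
    ∀ j, |pathSum (compensated (roundKernel D π) fun _ _ a => (a.2 j : ℝ)) h| < √(γ * T)

variable [∀ i, IsProbabilityMeasure (D i)]

lemma compensated_width (γ : ℝ) {t : ℕ} (h : History m d t) (a : Fin m × Obs d) :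
    compensated (roundKernel D π) (fun _ h a => width γ h a.1) t h a =
      width γ h a.1 - ∑ i, π.dist t h i * width γ h i := by
  have hmeas : Measurable fun a : Fin m × Obs d => width γ h a.1 :=
    (measurable_of_finite (width γ h)).comp measurable_fst
  rw [compensated, integral_roundKernel D π h hmeas fun i =>
    integrable_const (width γ h i)]
  simp

lemma measurable_uncurry_obs (j : Fin d) (t : ℕ) :
    Measurable (Function.uncurry fun (_ : History m d t) (a : Fin m × Obs d) => (a.2 j : ℝ)) :=
  (((measurable_obs_apply j).comp measurable_snd).comp measurable_snd :)

lemma compensated_obs (j : Fin d) {t : ℕ} (h : History m d t) (a : Fin m × Obs d) :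
    compensated (roundKernel D π) (fun _ _ a => (a.2 j : ℝ)) t h a =
      a.2 j - (meanMatrix D).mulVec (π.dist t h) j := by
  have hmeas : Measurable fun a : Fin m × Obs d => (a.2 j : ℝ) :=
    (measurable_obs_apply j).comp measurable_snd
  rw [compensated, integral_roundKernel D π h hmeas fun i => integrable_obs D j i]
  simp only [Matrix.mulVec, dotProduct, meanMatrix, mul_comm]

lemma histLaw_exists_notMem_confCube_le {γ : ℝ} (hγ : 2 ≤ γ) :
    histLaw D π T {h | ∃ s, meanMatrix D ∉ confCube γ (past h s)} ≤
      T * (d * (m * (T * (2 * ENNReal.ofReal (Real.exp (-(γ / 4))))))) := by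
  rw [Set.ofPred_exists]
  calc histLaw D π T (⋃ s, {h | meanMatrix D ∉ confCube γ (past h s)})
      ≤ ∑ s : Fin T, histLaw D π T {h | meanMatrix D ∉ confCube γ (past h s)} :=
        measure_iUnion_fintype_le _ _
    _ ≤ ∑ _s : Fin T, d * (m * (T * (2 * ENNReal.ofReal (Real.exp (-(γ / 4)))))) := by
        refine Finset.sum_le_sum fun s _ => (histLaw_preimage_past_le D π s
          {h | meanMatrix D ∉ confCube γ h}).trans
            ((histLaw_meanMatrix_notMem_confCube_le D π hγ s).trans ?_)
        gcongr
        exact_mod_cast s.isLt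
    _ = T * (d * (m * (T * (2 * ENNReal.ofReal (Real.exp (-(γ / 4))))))) := by simp

lemma histLaw_sqrt_le_abs_width_le {γ : ℝ} (hγ : 0 ≤ γ) (hT : 0 < T) :
    histLaw D π T {h | √(γ * T) ≤
      |pathSum (compensated (roundKernel D π) fun _ h a => width γ h a.1) h|} ≤
        2 * ENNReal.ofReal (Real.exp (-(2 * γ))) := by
  rw [histLaw_eq_trajLaw]
  exact trajLaw_sqrt_le_abs_pathSum_compensated_le (roundKernel D π)
    (fun t => measurable_width γ) (fun t h a => width_mem_Icc γ h a.1) hγ hT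

lemma histLaw_exists_sqrt_le_abs_obs_le {γ : ℝ} (hγ : 0 ≤ γ) (hT : 0 < T) :
    histLaw D π T {h | ∃ j, √(γ * T) ≤
      |pathSum (compensated (roundKernel D π) fun _ _ a => (a.2 j : ℝ)) h|} ≤
        d * (2 * ENNReal.ofReal (Real.exp (-(2 * γ)))) := by
  rw [Set.ofPred_exists, histLaw_eq_trajLaw]
  refine (measure_iUnion_fintype_le _ _).trans ((Finset.sum_le_sum fun j _ =>
    trajLaw_sqrt_le_abs_pathSum_compensated_le (roundKernel D π) (measurable_uncurry_obs j)
      (fun _ _ a => (a.2 j).2) hγ hT).trans_eq ?_)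
  simp

lemma histLaw_not_isTypical_le {γ : ℝ} (hγ : 2 ≤ γ) (hn : 0 < m * T * d) :
    histLaw D π T {h | ¬IsTypical D π γ h} ≤
      6 * ((m * T * d : ℕ) : ℝ≥0∞) ^ 2 * ENNReal.ofReal (Real.exp (-(γ / 4))) := by
  set e := ENNReal.ofReal (Real.exp (-(γ / 4)))
  have hγ0 : 0 ≤ γ := by linarith
  have hT : 0 < T := Nat.pos_of_ne_zero (by rintro rfl; simp at hn)
  have hone : (1 : ℝ≥0∞) ≤ (m * T * d : ℕ) := by exact_mod_cast hn
  have hTn : (T : ℝ≥0∞) ≤ (m * T * d : ℕ) :=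
    Nat.cast_le.2 (Nat.le_of_dvd hn ((dvd_mul_left T m).mul_right d))
  have hdn : (d : ℝ≥0∞) ≤ (m * T * d : ℕ) :=
    Nat.cast_le.2 (Nat.le_of_dvd hn (dvd_mul_left d _))
  have hexp : ENNReal.ofReal (Real.exp (-(2 * γ))) ≤ e :=
    ENNReal.ofReal_le_ofReal (Real.exp_le_exp.2 (by linarith))
  have hsplit : {h : History m d T | ¬IsTypical D π γ h} ⊆
      {h | ∃ s, meanMatrix D ∉ confCube γ (past h s)} ∪
        ({h | √(γ * T) ≤
            |pathSum (compensated (roundKernel D π) fun _ h a => width γ h a.1) h|} ∪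
          {h | ∃ j, √(γ * T) ≤
            |pathSum (compensated (roundKernel D π) fun _ _ a => (a.2 j : ℝ)) h|}) := by
    intro h hh
    contrapose! hh
    simp only [Set.mem_union, Set.mem_ofPred_eq, not_or, not_exists, not_not, not_le] at hh
    exact not_not.2 ⟨hh.1, hh.2.1, hh.2.2⟩
  calc histLaw D π T {h | ¬IsTypical D π γ h}
      ≤ T * (d * (m * (T * (2 * e)))) + (2 * ENNReal.ofReal (Real.exp (-(2 * γ))) +
          d * (2 * ENNReal.ofReal (Real.exp (-(2 * γ))))) := by
        refine (measure_mono hsplit).trans ((measure_union_le _ _).trans (add_le_add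
          (histLaw_exists_notMem_confCube_le D π hγ) ((measure_union_le _ _).trans (add_le_add
            (histLaw_sqrt_le_abs_width_le D π hγ0 hT)
            (histLaw_exists_sqrt_le_abs_obs_le D π hγ0 hT)))))
    _ = (m * T * d : ℕ) * (T * (2 * e)) + (1 * (1 * (2 * ENNReal.ofReal (Real.exp (-(2 * γ))))) +
          d * (1 * (2 * ENNReal.ofReal (Real.exp (-(2 * γ)))))) := by
        push_cast
        ring
    _ ≤ (m * T * d : ℕ) * ((m * T * d : ℕ) * (2 * e)) +
          ((m * T * d : ℕ) * ((m * T * d : ℕ) * (2 * e)) +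
            (m * T * d : ℕ) * ((m * T * d : ℕ) * (2 * e))) := by gcongr
    _ = 6 * ((m * T * d : ℕ) : ℝ≥0∞) ^ 2 * e := by ring

lemma six_mul_sq_mul_exp_le {n δ : ℝ} (hδ0 : 0 < δ) (hδ1 : δ ≤ 1) (hδn : 2 * δ ≤ n) :
    6 * n ^ 2 * Real.exp (-(20 * Real.log (n / δ) / 4)) ≤ δ := by
  have hn : 0 < n := by linarith
  have hexp : Real.exp (-(20 * Real.log (n / δ) / 4)) = (δ / n) ^ 5 := by
    rw [← inv_div n δ, inv_pow, ← Real.exp_log (pow_pos (div_pos hn hδ0) 5), ← Real.exp_neg,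
      Real.log_pow]
    push_cast
    ring_nf
  have hratio : δ / n ≤ 1 / 2 := by
    rw [div_le_div_iff₀ hn two_pos]
    linarith
  calc 6 * n ^ 2 * Real.exp (-(20 * Real.log (n / δ) / 4)) = 6 * δ ^ 2 * (δ / n) ^ 3 := by
        rw [hexp]
        field_simp
    _ ≤ 6 * δ ^ 2 * (1 / 2) ^ 3 := by gcongr
    _ ≤ δ := by nlinarith

lemma two_le_mul_log {n δ : ℝ} (hδ0 : 0 < δ) (hδn : 2 * δ ≤ n) :
    2 ≤ 20 * Real.log (n / δ) := by
  have hlog : Real.log 2 ≤ Real.log (n / δ) :=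
    Real.log_le_log two_pos ((le_div_iff₀ hδ0).2 hδn)
  linarith [Real.log_two_gt_d9]

lemma ofReal_one_sub_le_histLaw_isTypical {δ : ℝ} (hδ0 : 0 < δ) (hδ1 : δ ≤ 1)
    (hδn : 2 * δ ≤ m * T * d) :
    ENNReal.ofReal (1 - δ) ≤
      histLaw D π T {h | IsTypical D π (20 * Real.log (m * T * d / δ)) h} := by
  have hn : 0 < m * T * d := by
    have : (0 : ℝ) < m * T * d := by linarith
    exact_mod_cast this
  set γ : ℝ := 20 * Real.log (m * T * d / δ)
  have hfail : histLaw D π T {h | ¬IsTypical D π γ h} ≤ ENNReal.ofReal δ := by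
    refine (histLaw_not_isTypical_le D π (two_le_mul_log hδ0 hδn) hn).trans ?_
    rw [← ENNReal.ofReal_natCast, ← ENNReal.ofReal_pow (Nat.cast_nonneg _),
      ← ENNReal.ofReal_ofNat 6, ← ENNReal.ofReal_mul (by norm_num),
      ← ENNReal.ofReal_mul (by positivity)]
    refine ENNReal.ofReal_le_ofReal ?_
    push_cast
    exact six_mul_sq_mul_exp_le hδ0 hδ1 hδn
  rw [ENNReal.ofReal_sub _ hδ0.le, ENNReal.ofReal_one, tsub_le_iff_right]
  calc (1 : ℝ≥0∞) = histLaw D π T Set.univ := measure_univ.symm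
    _ ≤ histLaw D π T {h | IsTypical D π γ h} + histLaw D π T {h | ¬IsTypical D π γ h} :=
        (measure_mono fun h _ => em (IsTypical D π γ h)).trans (measure_union_le _ _)
    _ ≤ histLaw D π T {h | IsTypical D π γ h} + ENNReal.ofReal δ := by gcongr

end TypicalHistories

section CubeAndNorms

lemma mulVec_mem_cube {U : Matrix (Fin d) (Fin m) ℝ} (hU : ∀ j i, U j i ∈ Set.Icc (0 : ℝ) 1)
    {p : Fin m → ℝ} (hp : p ∈ stdSimplex ℝ (Fin m)) : U.mulVec p ∈ cube d := by
  have hnonneg : ∀ j, 0 ≤ ∑ i, U j i * p i := fun j =>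
    Finset.sum_nonneg fun i _ => mul_nonneg (hU j i).1 (hp.1 i)
  have hle_one : ∀ j, ∑ i, U j i * p i ≤ 1 := fun j =>
    (Finset.sum_le_sum fun i _ => mul_le_of_le_one_left (hp.1 i) (hU j i).2).trans_eq hp.2
  exact ⟨hnonneg, hle_one⟩

lemma mulVec_mem_cube_of_mem_confCube {γ : ℝ} {t : ℕ} {h : History m d t}
    {U : Matrix (Fin d) (Fin m) ℝ} (hU : U ∈ confCube γ h) {p : Fin m → ℝ}
    (hp : p ∈ stdSimplex ℝ (Fin m)) : U.mulVec p ∈ cube d :=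
  mulVec_mem_cube (fun j i => ⟨(le_max_left _ _).trans (hU j i).1,
    (hU j i).2.trans (min_le_left _ _)⟩) hp

lemma avgObs_mem_cube {T : ℕ} (h : History m d T) : avgObs h ∈ cube d := by
  refine ⟨fun j => div_nonneg (Finset.sum_nonneg fun s _ => ((h s).2 j).2.1) T.cast_nonneg,
    fun j => div_le_one_of_le₀ ?_ T.cast_nonneg⟩
  calc ∑ s, ((h s).2 j : ℝ) ≤ ∑ _s : Fin T, (1 : ℝ) :=
        Finset.sum_le_sum fun s _ => ((h s).2 j).2.2
    _ = T := by simp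

lemma integrable_of_mem_cube {Ω : Type*} [MeasurableSpace Ω] {μ : Measure Ω} [IsFiniteMeasure μ]
    {F : Ω → Fin d → ℝ} (hF : Measurable F) (hcube : ∀ ω, F ω ∈ cube d) : Integrable F μ :=
  Integrable.of_eval fun j => Integrable.of_mem_Icc 0 1 hF.eval.aemeasurable
    (ae_of_all _ fun ω => ⟨(hcube ω).1 j, (hcube ω).2 j⟩)

lemma measurable_avgObs {T : ℕ} : Measurable fun h : History m d T => avgObs h :=
  measurable_pi_lambda _ fun j => (Finset.measurable_fun_sum _ fun s _ =>
    (measurable_obs_apply j).comp (measurable_pi_apply s).snd).div_const _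

lemma lqNorm_le_norm_mul (q : ℝ≥0∞) [hq : Fact (1 ≤ q)] (x : Fin d → ℝ) :
    lqNorm q x ≤ ‖x‖ * lqNorm q (1 : Fin d → ℝ) := by
  have hconst : ‖x‖ * lqNorm q (1 : Fin d → ℝ) = lqNorm q (fun _ : Fin d => ‖x‖) := by
    have : (fun _ : Fin d => ‖x‖) = ‖x‖ • (1 : Fin d → ℝ) := by ext; simp
    rw [this, lqNorm, lqNorm, WithLp.toLp_smul, norm_smul, norm_norm]
  rw [hconst, lqNorm, lqNorm]
  rcases eq_or_ne q ∞ with rfl | hq'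
  · rw [PiLp.norm_eq_ciSup, PiLp.norm_eq_ciSup]
    refine ciSup_mono (Set.finite_range _).bddAbove fun j => ?_
    simpa using norm_le_pi_norm x j
  · have hpos : 0 < q.toReal := ENNReal.toReal_pos (zero_lt_one.trans_le hq.out).ne' hq'
    rw [PiLp.norm_eq_sum hpos, PiLp.norm_eq_sum hpos]
    gcongr with j
    simpa using norm_le_pi_norm x j

lemma lqNorm_nonneg (q : ℝ≥0∞) [Fact (1 ≤ q)] (x : Fin d → ℝ) : 0 ≤ lqNorm q x :=
  norm_nonneg (WithLp.toLp q x)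

lemma exists_lipschitzOnWith_cube {q : ℝ≥0∞} [Fact (1 ≤ q)] {f : (Fin d → ℝ) → ℝ} {L : ℝ}
    (hL : ∀ x ∈ cube d, ∀ y ∈ cube d, f x - f y ≤ L * lqNorm q (x - y)) :
    ∃ K : ℝ≥0, (K : ℝ) = L * lqNorm q (1 : Fin d → ℝ) ∧ LipschitzOnWith K f (cube d) := by
  have h0 : (0 : Fin d → ℝ) ∈ cube d := ⟨le_rfl, zero_le_one⟩
  have h1 : (1 : Fin d → ℝ) ∈ cube d := ⟨zero_le_one, le_rfl⟩
  have hneg : lqNorm q (0 - 1 : Fin d → ℝ) = lqNorm q (1 : Fin d → ℝ) := by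
    rw [zero_sub, lqNorm, WithLp.toLp_neg, norm_neg, lqNorm]
  have hup := hL 1 h1 0 h0
  have hdown := hL 0 h0 1 h1
  rw [sub_zero] at hup
  rw [hneg] at hdown
  have hK : 0 ≤ L * lqNorm q (1 : Fin d → ℝ) := by linarith
  refine ⟨(L * lqNorm q 1).toNNReal, Real.coe_toNNReal _ hK,
    LipschitzOnWith.of_le_add_mul _ fun x hx y hy => ?_⟩
  have hle := lqNorm_le_norm_mul q (x - y)
  have hxy := hL x hx y hy
  rw [Real.coe_toNNReal _ hK, dist_eq_norm]
  rcases le_or_gt 0 L with hL0 | hL0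
  · linarith [mul_le_mul_of_nonneg_left hle hL0]
  · linarith [mul_nonpos_of_nonpos_of_nonneg hL0.le (lqNorm_nonneg q (x - y)),
      mul_nonneg (norm_nonneg (x - y)) hK]

lemma mem_closure_toLp_image (q : ℝ≥0∞) {x : Fin d → ℝ} {S : Set (Fin d → ℝ)} :
    WithLp.toLp q x ∈ closure (WithLp.toLp q '' S) ↔ x ∈ closure S := by
  have himage : WithLp.toLp q '' closure S = closure (WithLp.toLp q '' S) :=
    (PiLp.homeomorph q fun _ : Fin d => ℝ).symm.image_closure S
  rw [← himage]
  exact (WithLp.toLp_injective q).mem_set_image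

lemma lqDist_nonpos_iff (q : ℝ≥0∞) [Fact (1 ≤ q)] {S : Set (Fin d → ℝ)} (hS : S.Nonempty)
    {x : Fin d → ℝ} : lqDist q x S ≤ 0 ↔ x ∈ closure S := by
  rw [← mem_closure_toLp_image q, Metric.mem_closure_iff_infDist_zero (hS.image _), lqDist]
  exact ⟨fun h => le_antisymm h Metric.infDist_nonneg, le_of_eq⟩

lemma lqDist_le_norm_mul (q : ℝ≥0∞) [Fact (1 ≤ q)] {S : Set (Fin d → ℝ)} {x y : Fin d → ℝ}
    (hy : y ∈ closure S) : lqDist q x S ≤ ‖x - y‖ * lqNorm q (1 : Fin d → ℝ) := by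
  refine le_trans ?_ (lqNorm_le_norm_mul q (x - y))
  rw [lqDist, ← Metric.infDist_closure, lqNorm, WithLp.toLp_sub, ← dist_eq_norm]
  exact Metric.infDist_le_dist_of_mem ((mem_closure_toLp_image q).2 hy)

end CubeAndNorms

section Benchmark

variable {T : ℕ} (D : Fin m → Measure (Obs d)) [∀ i, IsProbabilityMeasure (D i)] (π : Policy m d)

/-- The average of the distributions over arms used by the policy `π` along the history `h`. -/
def avgDist (h : History m d T) : Fin m → ℝ :=
  ∑ s : Fin T, (1 / T : ℝ) • π.dist s (past h s)

lemma sum_one_div_natCast (hT : 0 < T) : ∑ _s : Fin T, (1 / T : ℝ) = 1 := by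
  simp [hT.ne']

lemma avgDist_mem_stdSimplex (hT : 0 < T) (h : History m d T) :
    avgDist π h ∈ stdSimplex ℝ (Fin m) :=
  (convex_stdSimplex ℝ (Fin m)).sum_mem (fun _ _ => by positivity) (sum_one_div_natCast hT)
    fun s _ => π.mem_simplex s (past h s)

lemma measurable_avgDist : Measurable fun h : History m d T => avgDist π h :=
  Finset.measurable_fun_sum _ fun s _ =>
    ((π.measurable_dist s).comp (measurable_past s)).const_smul (1 / T : ℝ)

lemma avgObs_sub_mulVec_avgDist (h : History m d T) (j : Fin d) :
    avgObs h j - (meanMatrix D).mulVec (avgDist π h) j =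
      pathSum (compensated (roundKernel D π) fun _ _ a => (a.2 j : ℝ)) h / T := by
  simp only [pathSum, compensated_obs, avgObs, avgDist, Matrix.mulVec_sum, Matrix.mulVec_smul,
    Finset.sum_apply, Pi.smul_apply, smul_eq_mul, Finset.sum_sub_distrib, ← Finset.mul_sum]
  ring

lemma integral_avgObs_mem_image (hT : 0 < T) :
    ∫ h, avgObs h ∂histLaw D π T ∈ (meanMatrix D).mulVecLin '' stdSimplex ℝ (Fin m) := by
  have hobs : Integrable (fun h => avgObs h) (histLaw D π T) :=
    integrable_of_mem_cube measurable_avgObs avgObs_mem_cube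
  have hmean : Integrable (fun h => (meanMatrix D).mulVec (avgDist π h)) (histLaw D π T) :=
    integrable_of_mem_cube
      ((continuous_const.matrix_mulVec continuous_id).measurable.comp (measurable_avgDist π))
      fun h => mulVec_mem_cube (meanMatrix_mem_Icc D) (avgDist_mem_stdSimplex π hT h)
  have hcenter : ∫ h, (avgObs h - (meanMatrix D).mulVec (avgDist π h)) ∂histLaw D π T = 0 := by
    funext j
    refine (eval_integral (hobs.sub hmean).eval j).trans ?_
    simp only [Pi.sub_apply, avgObs_sub_mulVec_avgDist, integral_div, histLaw_eq_trajLaw]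
    rw [integral_pathSum_compensated _ (measurable_uncurry_obs j) fun _ _ a => (a.2 j).2]
    exact zero_div _
  rw [integral_sub hobs hmean, sub_eq_zero] at hcenter
  rw [hcenter]
  exact ((convex_stdSimplex ℝ (Fin m)).linear_image _).integral_mem
    ((isCompact_stdSimplex ℝ (Fin m)).image
      (LinearMap.continuous_of_finiteDimensional _)).isClosed
    (ae_of_all _ fun h => Set.mem_image_of_mem _ (avgDist_mem_stdSimplex π hT h)) hmean

lemma optValue_le {f : (Fin d → ℝ) → ℝ} {S : Set (Fin d → ℝ)} (hf : ConcaveOn ℝ (cube d) f)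
    (hfc : ContinuousOn f (cube d)) (hS : Convex ℝ S) (hT : 0 < T) {b : ℝ} (hb0 : 0 ≤ b)
    (hb : ∀ p ∈ stdSimplex ℝ (Fin m), (meanMatrix D).mulVec p ∈ closure S →
      f ((meanMatrix D).mulVec p) ≤ b) :
    optValue D f S T ≤ b := by
  refine Real.sSup_le ?_ hb0
  rintro r ⟨π, hπ, rfl⟩
  have hobs : Integrable (fun h => avgObs h) (histLaw D π T) :=
    integrable_of_mem_cube measurable_avgObs avgObs_mem_cube
  obtain ⟨C, hC⟩ := isCompact_Icc.exists_bound_of_continuousOn hfc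
  have hmeas : Measurable fun h : History m d T => f (avgObs h) :=
    (continuousOn_iff_continuous_domRestrict.1 hfc).measurable.comp
      (measurable_avgObs.subtype_mk (h := avgObs_mem_cube))
  have hint : Integrable (fun h => f (avgObs h)) (histLaw D π T) :=
    Integrable.of_bound hmeas.aestronglyMeasurable C
      (ae_of_all _ fun h => hC _ (avgObs_mem_cube h))
  have hclosure : ∫ h, avgObs h ∂histLaw D π T ∈ closure S :=
    hS.closure.integral_mem isClosed_closure (hπ.mono fun h hh => subset_closure hh) hobs
  obtain ⟨p, hp, hpE⟩ := integral_avgObs_mem_image D π hT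
  rw [← hpE] at hclosure
  calc ∫ h, f (avgObs h) ∂histLaw D π T ≤ f (∫ h, avgObs h ∂histLaw D π T) :=
        hf.le_map_integral hfc isClosed_Icc (ae_of_all _ avgObs_mem_cube) hobs hint
    _ = f ((meanMatrix D).mulVec p) := by rw [← hpE, Matrix.mulVecLin_apply]
    _ ≤ b := hb p hp hclosure

end Benchmark

section Regret

variable {T : ℕ} {D : Fin m → Measure (Obs d)} {π : Policy m d} {γ : ℝ}

lemma abs_mulVec_sub_mulVec_le (hγ : 0 ≤ γ) {t : ℕ} {h : History m d t}
    {U V : Matrix (Fin d) (Fin m) ℝ} (hU : U ∈ confCube γ h) (hV : V ∈ confCube γ h)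
    {p : Fin m → ℝ} (hp : ∀ i, 0 ≤ p i) (j : Fin d) :
    |U.mulVec p j - V.mulVec p j| ≤ ∑ i, p i * width γ h i := by
  calc |U.mulVec p j - V.mulVec p j| = |∑ i, p i * (U j i - V j i)| := by
        simp only [Matrix.mulVec, dotProduct, ← Finset.sum_sub_distrib, ← sub_mul, mul_comm]
    _ ≤ ∑ i, |p i * (U j i - V j i)| := Finset.abs_sum_le_sum_abs _ _
    _ ≤ ∑ i, p i * width γ h i := Finset.sum_le_sum fun i _ => by
        rw [abs_mul, abs_of_nonneg (hp i)]
        exact mul_le_mul_of_nonneg_left (abs_sub_le_width hγ hU hV j i) (hp i)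

variable {h : History m d T}

lemma IsTypical.mem_feasible {q : ℝ≥0∞} [Fact (1 ≤ q)] {S : Set (Fin d → ℝ)}
    (hh : IsTypical D π γ h) {p : Fin m → ℝ} (hp : p ∈ stdSimplex ℝ (Fin m))
    (hpS : (meanMatrix D).mulVec p ∈ closure S) (s : Fin T) :
    p ∈ feasible q γ S (past h s) :=
  ⟨hp, meanMatrix D, hh.mem_confCube s,
    (lqDist_nonpos_iff q (closure_nonempty_iff.1 ⟨_, hpS⟩)).2 hpS⟩

variable [∀ i, IsProbabilityMeasure (D i)]

lemma IsTypical.sum_dist_mul_width_le (hh : IsTypical D π γ h) (hγ : 0 ≤ γ) :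
    ∑ s : Fin T, ∑ i, π.dist s (past h s) i * width γ (past h s) i ≤
      16 * √(γ * m * T) + √(γ * T) := by
  have hcompensated : pathSum (compensated (roundKernel D π) fun _ h a => width γ h a.1) h =
      pathSum (fun _ h a => width γ h a.1) h -
        ∑ s : Fin T, ∑ i, π.dist s (past h s) i * width γ (past h s) i := by
    simp only [pathSum, compensated_width, Finset.sum_sub_distrib]
  linarith [(abs_lt.1 hh.abs_pathSum_width_lt).1, pathSum_width_le hγ h]

lemma IsTypical.abs_sum_mulVec_sub_obs_le (hh : IsTypical D π γ h) (hγ : 0 ≤ γ)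
    {U : Fin T → Matrix (Fin d) (Fin m) ℝ} (hU : ∀ s, U s ∈ confCube γ (past h s)) (j : Fin d) :
    |∑ s, ((U s).mulVec (π.dist s (past h s)) j - ((h s).2 j : ℝ))| ≤
      16 * √(γ * m * T) + 2 * √(γ * T) := by
  have hmodel : |∑ s : Fin T, ((U s).mulVec (π.dist s (past h s)) j -
      (meanMatrix D).mulVec (π.dist s (past h s)) j)| ≤ 16 * √(γ * m * T) + √(γ * T) :=
    (Finset.abs_sum_le_sum_abs _ _).trans ((Finset.sum_le_sum fun s _ =>
      abs_mulVec_sub_mulVec_le hγ (hU s) (hh.mem_confCube s) (π.mem_simplex s _).1 j).trans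
        (hh.sum_dist_mul_width_le hγ))
  have hnoise := hh.abs_pathSum_obs_lt j
  simp only [pathSum, compensated_obs] at hnoise
  calc |∑ s, ((U s).mulVec (π.dist s (past h s)) j - ((h s).2 j : ℝ))|
      = |∑ s : Fin T, ((U s).mulVec (π.dist s (past h s)) j -
            (meanMatrix D).mulVec (π.dist s (past h s)) j) -
          ∑ s : Fin T, ((h s).2 j - (meanMatrix D).mulVec (π.dist s (past h s)) j)| := by
        rw [← Finset.sum_sub_distrib]
        simp only [sub_sub_sub_cancel_right]
    _ ≤ (16 * √(γ * m * T) + √(γ * T)) + √(γ * T) :=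
        (abs_sub _ _).trans (add_le_add hmodel hnoise.le)
    _ = 16 * √(γ * m * T) + 2 * √(γ * T) := by ring

lemma IsTypical.norm_sum_smul_mulVec_sub_avgObs_le (hh : IsTypical D π γ h) (hγ : 0 ≤ γ)
    {U : Fin T → Matrix (Fin d) (Fin m) ℝ} (hU : ∀ s, U s ∈ confCube γ (past h s)) :
    ‖∑ s, (1 / T : ℝ) • (U s).mulVec (π.dist s (past h s)) - avgObs h‖ ≤
      18 * √(γ * m / T) := by
  have hmono : √(γ * T) ≤ √(γ * m * T) := by
    have : T ≤ m * T := T.eq_zero_or_pos.elim (fun hT => by simp [hT]) fun hT =>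
      Nat.le_mul_of_pos_left T (h ⟨0, hT⟩).1.pos
    rw [mul_assoc]
    gcongr
    exact_mod_cast this
  have hscale : √(γ * m * T) / T = √(γ * m / T) := by
    nth_rw 2 [← Real.sqrt_sq T.cast_nonneg]
    rw [← Real.sqrt_div' _ (sq_nonneg _), pow_two, mul_div_assoc, div_self_mul_self',
      ← div_eq_mul_inv]
  refine (pi_norm_le_iff_of_nonneg (by positivity)).2 fun j => ?_
  have hcoord : (∑ s, (1 / T : ℝ) • (U s).mulVec (π.dist s (past h s)) - avgObs h) j =
      (∑ s, ((U s).mulVec (π.dist s (past h s)) j - ((h s).2 j : ℝ))) / T := by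
    simp only [Pi.sub_apply, Finset.sum_apply, Pi.smul_apply, smul_eq_mul, ← Finset.mul_sum,
      Finset.sum_sub_distrib, avgObs]
    ring
  rw [hcoord, Real.norm_eq_abs, abs_div, Nat.abs_cast, ← hscale, ← mul_div_assoc]
  gcongr
  linarith [hh.abs_sum_mulVec_sub_obs_le hγ hU j]

lemma IsTypical.objective_sub_le {q : ℝ≥0∞} [Fact (1 ≤ q)] {f : (Fin d → ℝ) → ℝ} {K : ℝ≥0}
    {S : Set (Fin d → ℝ)} (hh : IsTypical D π γ h) (hf : ConcaveOn ℝ (cube d) f)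
    (hfK : LipschitzOnWith K f (cube d)) (hγ : 0 ≤ γ) (hT : 0 < T)
    (hπ : IsUCBPolicy q γ f S T π) {p : Fin m → ℝ} (hp : p ∈ stdSimplex ℝ (Fin m))
    (hpS : (meanMatrix D).mulVec p ∈ closure S) :
    f ((meanMatrix D).mulVec p) - f (avgObs h) ≤ 18 * (K * √(γ * m / T)) := by
  have hfeas := hh.mem_feasible (q := q) hp hpS
  choose U hU hopt using fun s : Fin T => (hπ s s.isLt (past h s) ⟨p, hfeas s⟩).2
  set x : Fin T → Fin d → ℝ := fun s => (U s).mulVec (π.dist s (past h s))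
  have hx : ∀ s ∈ Finset.univ, x s ∈ cube d := fun s _ =>
    mulVec_mem_cube_of_mem_confCube (hU s) (π.mem_simplex _ _)
  have hw : ∀ s ∈ (Finset.univ : Finset (Fin T)), (0 : ℝ) ≤ 1 / T := fun _ _ => by positivity
  have hw1 := sum_one_div_natCast hT
  have hoptimism : f ((meanMatrix D).mulVec p) ≤ f (∑ s, (1 / T : ℝ) • x s) :=
    calc f ((meanMatrix D).mulVec p)
        = ∑ _s : Fin T, (1 / T : ℝ) • f ((meanMatrix D).mulVec p) := by
          rw [← Finset.sum_smul, hw1, one_smul]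
      _ ≤ ∑ s, (1 / T : ℝ) • f (x s) := Finset.sum_le_sum fun s hs =>
          smul_le_smul_of_nonneg_left (hopt s p (hfeas s) _ (hh.mem_confCube s)) (hw s hs)
      _ ≤ f (∑ s, (1 / T : ℝ) • x s) := hf.le_map_sum hw hw1 hx
  have hlipschitz := hfK.le_add_mul (hf.1.sum_mem hw hw1 hx) (avgObs_mem_cube h)
  have hdist := mul_le_mul_of_nonneg_left
    (hh.norm_sum_smul_mulVec_sub_avgObs_le hγ hU) K.coe_nonneg
  rw [dist_eq_norm] at hlipschitz
  linarith

lemma IsTypical.regretObj_le {q : ℝ≥0∞} [Fact (1 ≤ q)] {f : (Fin d → ℝ) → ℝ} {K : ℝ≥0}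
    {S : Set (Fin d → ℝ)} (hh : IsTypical D π γ h) (hf0 : ∀ x ∈ cube d, 0 ≤ f x)
    (hf : ConcaveOn ℝ (cube d) f) (hfK : LipschitzOnWith K f (cube d)) (hS : Convex ℝ S)
    (hγ : 0 ≤ γ) (hT : 0 < T) (hπ : IsUCBPolicy q γ f S T π) :
    regretObj D f S h ≤ 18 * (K * √(γ * m / T)) := by
  have havg := hf0 _ (avgObs_mem_cube h)
  rw [regretObj, sub_le_iff_le_add]
  refine optValue_le D hf hfK.continuousOn hS hT (by positivity) fun p hp hpS => ?_
  exact sub_le_iff_le_add.1 (hh.objective_sub_le hf hfK hγ hT hπ hp hpS)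

lemma IsTypical.regretCon_le {q : ℝ≥0∞} [Fact (1 ≤ q)] {f : (Fin d → ℝ) → ℝ}
    {S : Set (Fin d → ℝ)} (hh : IsTypical D π γ h) (hS : Convex ℝ S) (hγ : 0 ≤ γ)
    (hT : 0 < T) (hπ : IsUCBPolicy q γ f S T π) {p : Fin m → ℝ} (hp : p ∈ stdSimplex ℝ (Fin m))
    (hpS : (meanMatrix D).mulVec p ∈ closure S) :
    regretCon q S h ≤ 18 * (lqNorm q (1 : Fin d → ℝ) * √(γ * m / T)) := by
  have hfeas := hh.mem_feasible (q := q) hp hpS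
  choose U hU hUS using fun s : Fin T => (hπ s s.isLt (past h s) ⟨p, hfeas s⟩).1.2
  have hmem : ∑ s, (1 / T : ℝ) • (U s).mulVec (π.dist s (past h s)) ∈ closure S :=
    hS.closure.sum_mem (fun _ _ => by positivity) (sum_one_div_natCast hT) fun s _ =>
      (lqDist_nonpos_iff q (closure_nonempty_iff.1 ⟨_, hpS⟩)).1 (hUS s)
  have hnorm := hh.norm_sum_smul_mulVec_sub_avgObs_le hγ hU
  rw [norm_sub_rev] at hnorm
  calc regretCon q S h ≤ _ := lqDist_le_norm_mul q hmem
    _ ≤ 18 * √(γ * m / T) * lqNorm q (1 : Fin d → ℝ) :=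
        mul_le_mul_of_nonneg_right hnorm (lqNorm_nonneg q _)
    _ = 18 * (lqNorm q (1 : Fin d → ℝ) * √(γ * m / T)) := by ring

end Regret

end BwCR

end

theorem theorem1 :
    ∃ c > (0 : ℝ), ∃ C > (0 : ℝ),
      ∀ (m d T : ℕ) (q₁ q₂ : ℝ≥0∞) [Fact (1 ≤ q₁)] [Fact (1 ≤ q₂)]
        -- the unknown distributions of the arms
        (D : Fin m → Measure (BwCR.Obs d)) [∀ i, IsProbabilityMeasure (D i)]
        -- the objective and the constraint set
        (f : (Fin d → ℝ) → ℝ) (L : ℝ) (S : Set (Fin d → ℝ)),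
        (∀ x ∈ BwCR.cube d, f x ∈ Set.Icc (0 : ℝ) 1) →
        ConcaveOn ℝ (BwCR.cube d) f →
        (∀ x ∈ BwCR.cube d, ∀ y ∈ BwCR.cube d, f x - f y ≤ L * BwCR.lqNorm q₁ (x - y)) →
        Convex ℝ S →
        -- the benchmark problem is feasible
        (∃ p ∈ stdSimplex ℝ (Fin m), (BwCR.meanMatrix D).mulVec p ∈ S) →
        ∀ δ : ℝ, 0 < δ → δ < 1 → 2 * δ ≤ (m * T * d : ℝ) →
        ∀ γ : ℝ, γ = c * Real.log (m * T * d / δ) →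
        ∀ π : BwCR.Policy m d, BwCR.IsUCBPolicy q₂ γ f S T π →
          ENNReal.ofReal (1 - δ) ≤ BwCR.histLaw D π T
            {h | BwCR.regretObj D f S h
                  ≤ C * (L * BwCR.lqNorm q₁ (1 : Fin d → ℝ) * Real.sqrt (γ * m / T)) ∧
                (∀ p ∈ stdSimplex ℝ (Fin m), (BwCR.meanMatrix D).mulVec p ∈ S →
                  f ((BwCR.meanMatrix D).mulVec p) - f (BwCR.avgObs h)
                    ≤ C * (L * BwCR.lqNorm q₁ (1 : Fin d → ℝ) * Real.sqrt (γ * m / T))) ∧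
                BwCR.regretCon q₂ S h
                  ≤ C * (BwCR.lqNorm q₂ (1 : Fin d → ℝ) * Real.sqrt (γ * m / T))} := by
  refine ⟨20, by norm_num, 18, by norm_num, ?_⟩
  rintro m d T q₁ q₂ _ _ D _ f L S hf01 hf hL hS ⟨p₀, hp₀, hp₀S⟩ δ hδ0 hδ1 hδ γ rfl π hπ
  obtain ⟨K, hK, hfK⟩ := BwCR.exists_lipschitzOnWith_cube hL
  have hT : 0 < T := Nat.pos_of_ne_zero fun hT => by
    rw [hT, Nat.cast_zero] at hδ
    linarith
  have hγ : 0 ≤ 20 * Real.log (m * T * d / δ) := zero_le_two.trans (BwCR.two_le_mul_log hδ0 hδ)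
  refine (BwCR.ofReal_one_sub_le_histLaw_isTypical D π hδ0 hδ1.le hδ).trans
    (measure_mono fun h hh => ?_)
  rw [← hK]
  exact ⟨hh.regretObj_le (fun x hx => (hf01 x hx).1) hf hfK hS hγ hT hπ,
    fun p hp hpS => hh.objective_sub_le hf hfK hγ hT hπ hp (subset_closure hpS),
    hh.regretCon_le hS hγ hT hπ hp₀ (subset_closure hp₀S)⟩
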